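/- Let $G$ be a (finite-dimensional, real) Lie group with Lie algebra $\mathfrak g=T_1G$, whose bracket is the Lie bracket of left-invariant vector fields. For $g\in G$ let ${\rm Ad}_g:\mathfrak g\to\mathfrak g$ be the differential at $1$ of the conjugation $h\mapsto ghg^{-1}$. Let $\mathcal B:\mathfrak g\to G$ be a Rota-Baxter operator of weight $0$ on $G$, that is, a smooth map with $$\mathcal B(x)\,\mathcal B(y)=\mathcal B\big(x+{\rm Ad}_{\mathcal B(x)}y\big)\qquad\text{for all }x,y\in\mathfrak g$$ (so that $\mathcal B(0)=1$). Then the differential $B=\mathcal B_{*0}:\mathfrak g=T_0\mathfrak g\to T_1G=\mathfrak g$ of $\mathcal B$ at $0$ is a Rota-Baxter operator of weight $0$ on the Lie algebra $\mathfrak g$, that is, it is a linear map with $$[B(x),B(y)]=B\big([B(x),y]+[x,B(y)]\big)\qquad\text{for all }x,y\in\mathfrak g.$$ -/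

import Mathlib

open scoped Manifold ContDiff

noncomputable section

/-- The differential `d f_x : T_x M → T_y N` of a map `f` with `f x = y`, as a continuous linear map
into the tangent space at the point `y` (the equality `f x = y` identifies `T_{f x} N` with
`T_y N`). -/
def differentialAt
    {E : Type*} [NormedAddCommGroup E] [NormedSpace ℝ E]
    {H : Type*} [TopologicalSpace H] (I : ModelWithCorners ℝ E H)
    {M : Type*} [TopologicalSpace M] [ChartedSpace H M]
    {E' : Type*} [NormedAddCommGroup E'] [NormedSpace ℝ E']
    {H' : Type*} [TopologicalSpace H'] (I' : ModelWithCorners ℝ E' H')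
    {N : Type*} [TopologicalSpace N] [ChartedSpace H' N]
    (f : M → N) (x : M) (y : N) (h : f x = y) :
    TangentSpace I x →L[ℝ] TangentSpace I' y :=
  h ▸ mfderiv I I' f x

section LieGroupDefs

variable {E : Type*} [NormedAddCommGroup E] [NormedSpace ℝ E]
  {H : Type*} [TopologicalSpace H] (I : ModelWithCorners ℝ E H)
  {G : Type*} [TopologicalSpace G] [ChartedSpace H G] [Group G]

/-- The adjoint action `Ad_g : 𝔤 → 𝔤`, the differential at `1` of the conjugation
`h ↦ g * h * g⁻¹`. -/
def lieAd (g : G) : GroupLieAlgebra I G →L[ℝ] GroupLieAlgebra I G :=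
  differentialAt I I (fun h : G ↦ g * h * g⁻¹) 1 1 (by simp)

/-- A Rota-Baxter operator of weight `0` on a Lie group `G` with Lie algebra `𝔤 = T_1 G`: a smooth
map `𝓑 : 𝔤 → G` with `𝓑 x * 𝓑 y = 𝓑 (x + Ad_{𝓑 x} y)`. In Mathlib the vector space underlying the
tangent space `T_1 G` is the model space `E`, so that smoothness on the finite-dimensional vector
space `𝔤` is smoothness on `E`. -/
structure IsLieGroupRotaBaxter (𝓑 : GroupLieAlgebra I G → G) : Prop where
  smooth : ContMDiff 𝓘(ℝ, E) I ∞ (fun v : E ↦ 𝓑 v)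
  mul_eq : ∀ x y : GroupLieAlgebra I G, 𝓑 x * 𝓑 y = 𝓑 (x + lieAd I (𝓑 x) y)

variable {I}

theorem IsLieGroupRotaBaxter.map_zero {𝓑 : GroupLieAlgebra I G → G}
    (h𝓑 : IsLieGroupRotaBaxter I 𝓑) : 𝓑 0 = 1 := by
  have h := h𝓑.mul_eq 0 0
  rw [ContinuousLinearMap.map_zero, add_zero] at h
  exact mul_eq_left.mp h

/-- The differential `B = 𝓑_{*0} : 𝔤 → 𝔤` at `0` of a Rota-Baxter operator `𝓑 : 𝔤 → G` of
weight `0`, where `T_0 𝔤` is identified with the vector space `𝔤` and `𝓑 0 = 1`. -/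
def IsLieGroupRotaBaxter.differential {𝓑 : GroupLieAlgebra I G → G}
    (h𝓑 : IsLieGroupRotaBaxter I 𝓑) : GroupLieAlgebra I G →L[ℝ] GroupLieAlgebra I G :=
  differentialAt 𝓘(ℝ, E) I (fun v : E ↦ 𝓑 v) 0 1 h𝓑.map_zero

end LieGroupDefs

end

/-!
The whole computation takes place in the extended chart `φ` of `G` at `1`. Write `p = φ 1` and
`m (a, b) = φ (φ⁻¹ a * φ⁻¹ b)` for the multiplication read in this chart, and let
`β u v = D²m (p, p) ((u, 0), (0, v))` be its mixed second derivative at the unit. The partial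
derivatives of `m` are `∂₁m q v = fderiv ℝ m q (v, 0)` and `∂₂m q v = fderiv ℝ m q (0, v)`.

* The left-invariant vector field of `v` reads `a ↦ ∂₂m (a, p) v` in the chart, so the Lie bracket
  is `[u, v] = β u v - β v u` (`bracket_eq_localBracket`).
* Differentiating `g h = (g h g⁻¹) g` in `h` at `1` gives
  `∂₂m (φ g, p) y = ∂₁m (p, φ g) (Ad_g y)` (`fderiv_chartMul_lieAd`). Since `∂₁m (p, p) = id`, the
  operator `∂₁m (p, φ g)` is invertible for `g` near `1`. Thus `Ad` is differentiable there, and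
  differentiating once more gives the derivative `y ↦ [u, y]` of `Ad` in the direction `u`
  (`localAd_derivative`).
* Write `F = φ ∘ 𝓑` and `B = DF 0`. The Rota-Baxter identity, differentiated in `y` at `0`, says
  `∂₂m (F x, p) (B y) = DF x (Ad_{𝓑 x} y)` (`IsLieGroupRotaBaxter.fderiv_chartMul_apply`).
  Differentiating this in `x` at `0` yields `β (B x) (B y) = B [B x, y] + D²F 0 (x, y)`. The last
  term is symmetric in `x` and `y`, so antisymmetrizing removes it and leaves the identity to be
  proved (`localBracket_rotaBaxter`).
-/

section LocalCalculus

/-! ### Second-order calculus of a local multiplication -/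

open Filter VectorField
open scoped Topology

variable {E : Type*} [NormedAddCommGroup E] [NormedSpace ℝ E]

/-- The mixed second derivative at `(p, p)` of a map `m : E × E → E`, with `u` in the first factor
and `v` in the second. -/
noncomputable def mixedDeriv (m : E × E → E) (p u v : E) : E :=
  fderiv ℝ (fderiv ℝ m) (p, p) (u, 0) (0, v)

/-- The bracket on `E` obtained by antisymmetrizing the mixed second derivative of `m` at `(p, p)`;
the Lie bracket if `m` is a group multiplication with unit `p` read in a chart. -/
noncomputable def localBracket (m : E × E → E) (p u v : E) : E :=
  mixedDeriv m p u v - mixedDeriv m p v u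

variable {m : E × E → E} {p : E}

theorem fderiv_apply_inl_of_right_unit (hm : ContDiffAt ℝ 2 m (p, p))
    (hright : ∀ᶠ a in 𝓝 p, m (a, p) = a) (v : E) : fderiv ℝ m (p, p) (v, 0) = v := by
  have h1 : HasFDerivAt (fun a : E ↦ m (a, p))
      ((fderiv ℝ m (p, p)).comp (ContinuousLinearMap.inl ℝ E E)) p :=
    HasFDerivAt.comp p (hm.differentiableAt (by norm_num)).hasFDerivAt
      (hasFDerivAt_prodMk_left p p)
  have h2 : HasFDerivAt (fun a : E ↦ m (a, p)) (.id ℝ E) p :=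
    (hasFDerivAt_id p).congr_of_eventuallyEq hright
  simpa using congr($(h1.unique h2) v)

theorem fderiv_apply_inr_of_left_unit (hm : ContDiffAt ℝ 2 m (p, p))
    (hleft : ∀ᶠ a in 𝓝 p, m (p, a) = a) (v : E) : fderiv ℝ m (p, p) (0, v) = v := by
  have h1 : HasFDerivAt (fun a : E ↦ m (p, a))
      ((fderiv ℝ m (p, p)).comp (ContinuousLinearMap.inr ℝ E E)) p :=
    HasFDerivAt.comp p (hm.differentiableAt (by norm_num)).hasFDerivAt
      (hasFDerivAt_prodMk_right p p)
  have h2 : HasFDerivAt (fun a : E ↦ m (p, a)) (.id ℝ E) p :=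
    (hasFDerivAt_id p).congr_of_eventuallyEq hleft
  simpa using congr($(h1.unique h2) v)

theorem differentiableAt_fderiv_of_contDiffAt_two {X Y : Type*} [NormedAddCommGroup X]
    [NormedSpace ℝ X] [NormedAddCommGroup Y] [NormedSpace ℝ Y] {f : X → Y} {x : X}
    (hf : ContDiffAt ℝ 2 f x) : DifferentiableAt ℝ (fderiv ℝ f) x :=
  (hf.fderiv_right (m := 1) (by norm_num)).differentiableAt (by norm_num)

/-- The fields `a ↦ ∂₂m (a, p) v` are the left-invariant vector fields of the local multiplication
`m`. -/
theorem lieBracket_fderiv_apply_inr (hm : ContDiffAt ℝ 2 m (p, p))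
    (hleft : ∀ᶠ a in 𝓝 p, m (p, a) = a) (v w : E) :
    lieBracket ℝ (fun a ↦ fderiv ℝ m (a, p) (0, v)) (fun a ↦ fderiv ℝ m (a, p) (0, w)) p =
      localBracket m p v w := by
  have key (w u : E) : fderiv ℝ (fun a ↦ fderiv ℝ m (a, p) (0, w)) p u = mixedDeriv m p u w := by
    have h : HasFDerivAt (fun a : E ↦ fderiv ℝ m (a, p)) _ p :=
      HasFDerivAt.comp p (differentiableAt_fderiv_of_contDiffAt_two hm).hasFDerivAt
        (hasFDerivAt_prodMk_left p p)
    rw [(h.clm_apply (hasFDerivAt_const ((0 : E), w) p)).fderiv]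
    simp [mixedDeriv]
  simp only [lieBracket, key, fderiv_apply_inr_of_left_unit hm hleft, localBracket]

/-- The relation `∂₂m (F x, p) = ∂₁m (p, F x) ∘ A x` determines `A` near `0`, because
`∂₁m (p, p) = id` is invertible. Hence `A` is differentiable at `0` although no regularity of `A` is
assumed. -/
theorem localAd_derivative [CompleteSpace E] (hm : ContDiffAt ℝ 2 m (p, p))
    (hleft : ∀ᶠ a in 𝓝 p, m (p, a) = a) (hright : ∀ᶠ a in 𝓝 p, m (a, p) = a)
    {F : E → E} (hF : DifferentiableAt ℝ F 0) (hF0 : F 0 = p) {A : E → E →L[ℝ] E}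
    (hA : ∀ᶠ x in 𝓝 0, ∀ y, fderiv ℝ m (F x, p) (0, y) = fderiv ℝ m (p, F x) (A x y, 0)) :
    DifferentiableAt ℝ A 0 ∧ A 0 = .id ℝ E ∧
      ∀ x y, fderiv ℝ A 0 x y = localBracket m p (fderiv ℝ F 0 x) y := by
  have hm₁ : HasFDerivAt (fderiv ℝ m) (fderiv ℝ (fderiv ℝ m) (p, p)) (p, F 0) := by
    rw [hF0]; exact (differentiableAt_fderiv_of_contDiffAt_two hm).hasFDerivAt
  have hm₂ : HasFDerivAt (fderiv ℝ m) (fderiv ℝ (fderiv ℝ m) (p, p)) (F 0, p) := by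
    rw [hF0]; exact (differentiableAt_fderiv_of_contDiffAt_two hm).hasFDerivAt
  have h1 : HasFDerivAt (fun x ↦ fderiv ℝ m (p, F x)) _ 0 :=
    HasFDerivAt.comp (0 : E) hm₁ ((hasFDerivAt_const p (0 : E)).prodMk hF.hasFDerivAt)
  have h2 : HasFDerivAt (fun x ↦ fderiv ℝ m (F x, p)) _ 0 :=
    HasFDerivAt.comp (0 : E) hm₂ (hF.hasFDerivAt.prodMk (hasFDerivAt_const p (0 : E)))
  set R : E → E →L[ℝ] E := fun x ↦ (fderiv ℝ m (p, F x)).comp (.inl ℝ E E) with hR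
  set L : E → E →L[ℝ] E := fun x ↦ (fderiv ℝ m (F x, p)).comp (.inr ℝ E E) with hL
  have hRd : DifferentiableAt ℝ R 0 := h1.differentiableAt.clm_comp (differentiableAt_const _)
  have hLd : DifferentiableAt ℝ L 0 := h2.differentiableAt.clm_comp (differentiableAt_const _)
  have hR0 : R 0 = 1 := by
    ext v; simp [hR, hF0, fderiv_apply_inl_of_right_unit hm hright]
  have hunit : ∀ᶠ x in 𝓝 (0 : E), IsUnit (R x) :=
    hRd.continuousAt.eventually_mem
      (by rw [hR0]; exact Units.isOpen.mem_nhds isUnit_one)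
  have hAeq : A =ᶠ[𝓝 0] fun x ↦ Ring.inverse (R x) * L x := by
    filter_upwards [hunit, hA] with x hu hx
    have : L x = R x * A x := by ext y; simpa [hL, hR] using hx y
    rw [this, Ring.inverse_mul_cancel_left _ _ hu]
  have hAd : DifferentiableAt ℝ A 0 := by
    refine DifferentiableAt.congr_of_eventuallyEq ?_ hAeq
    have hinv : DifferentiableAt ℝ (Ring.inverse : (E →L[ℝ] E) → E →L[ℝ] E) (R 0) :=
      differentiableAt_inverse (by rw [hR0]; exact isUnit_one)
    exact (hinv.comp (0 : E) hRd).clm_comp hLd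
  have hA0 : A 0 = .id ℝ E := by
    ext v
    have := hA.self_of_nhds v
    rw [hF0, fderiv_apply_inr_of_left_unit hm hleft,
      fderiv_apply_inl_of_right_unit hm hright] at this
    simpa using this.symm
  refine ⟨hAd, hA0, fun x y ↦ ?_⟩
  -- Differentiate `∂₂m (F z, p) y = ∂₁m (p, F z) (A z y)` in `z` at `0`.
  have hAy : HasFDerivAt (fun z ↦ (A z y, (0 : E))) _ 0 :=
    (hAd.hasFDerivAt.clm_apply (hasFDerivAt_const y (0 : E))).prodMk (hasFDerivAt_const (0 : E) 0)
  have hlhs := h2.clm_apply (hasFDerivAt_const ((0 : E), y) (0 : E))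
  have hrhs := h1.clm_apply hAy
  have heq := (hlhs.congr_of_eventuallyEq (hA.mono fun z hz ↦ (hz y).symm)).unique hrhs
  have heq := congr($heq x)
  have hsymm := (hm.isSymmSndFDerivAt (by simp)).eq (0, fderiv ℝ F 0 x) (y, 0)
  have heq' : mixedDeriv m p (fderiv ℝ F 0 x) y =
      fderiv ℝ A 0 x y + mixedDeriv m p y (fderiv ℝ F 0 x) := by
    simpa [mixedDeriv, hA0, hF0, fderiv_apply_inl_of_right_unit hm hright, hsymm] using heq
  rw [localBracket, heq', add_sub_cancel_right]

/-- The first-order consequence `hRB` of the Rota-Baxter identity for `F` implies the infinitesimal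
Rota-Baxter identity for the derivative of `F` at `0`. -/
theorem localBracket_rotaBaxter [CompleteSpace E] (hm : ContDiffAt ℝ 2 m (p, p))
    (hleft : ∀ᶠ a in 𝓝 p, m (p, a) = a) (hright : ∀ᶠ a in 𝓝 p, m (a, p) = a)
    {F : E → E} (hF : ContDiffAt ℝ 2 F 0) (hF0 : F 0 = p) {A : E → E →L[ℝ] E}
    (hA : ∀ᶠ x in 𝓝 0, ∀ y, fderiv ℝ m (F x, p) (0, y) = fderiv ℝ m (p, F x) (A x y, 0))
    (hRB : ∀ᶠ x in 𝓝 0, ∀ y,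
      fderiv ℝ m (F x, p) (0, fderiv ℝ F 0 y) = fderiv ℝ F x (A x y)) (x y : E) :
    localBracket m p (fderiv ℝ F 0 x) (fderiv ℝ F 0 y) =
      fderiv ℝ F 0 (localBracket m p (fderiv ℝ F 0 x) y + localBracket m p x (fderiv ℝ F 0 y)) := by
  have hFd := hF.differentiableAt (by norm_num)
  obtain ⟨hAd, hA0, hAder⟩ := localAd_derivative hm hleft hright hFd hF0 hA
  have hm₂ : HasFDerivAt (fderiv ℝ m) (fderiv ℝ (fderiv ℝ m) (p, p)) (F 0, p) := by
    rw [hF0]; exact (differentiableAt_fderiv_of_contDiffAt_two hm).hasFDerivAt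
  have h2 : HasFDerivAt (fun x ↦ fderiv ℝ m (F x, p)) _ 0 :=
    HasFDerivAt.comp (0 : E) hm₂ (hFd.hasFDerivAt.prodMk (hasFDerivAt_const p (0 : E)))
  have hF' := (differentiableAt_fderiv_of_contDiffAt_two hF).hasFDerivAt
  -- Differentiate `hRB` in the base point, at `0`.
  have key (x y : E) : mixedDeriv m p (fderiv ℝ F 0 x) (fderiv ℝ F 0 y) =
      fderiv ℝ F 0 (localBracket m p (fderiv ℝ F 0 x) y) + fderiv ℝ (fderiv ℝ F) 0 x y := by
    have hlhs := h2.clm_apply (hasFDerivAt_const ((0 : E), fderiv ℝ F 0 y) (0 : E))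
    have hrhs := hF'.clm_apply (hAd.hasFDerivAt.clm_apply (hasFDerivAt_const y (0 : E)))
    have heq := congr($((hlhs.congr_of_eventuallyEq (hRB.mono fun z hz ↦ (hz y).symm)).unique
      hrhs) x)
    simpa [hA0, hAder, mixedDeriv] using heq
  -- The symmetric second derivatives of `F` cancel on antisymmetrizing.
  rw [localBracket, key x y, key y x, (hF.isSymmSndFDerivAt (by simp)).eq y x,
    show localBracket m p x (fderiv ℝ F 0 y) = -localBracket m p (fderiv ℝ F 0 y) x by
      simp [localBracket]]
  rw [map_add, map_neg]
  abel

end LocalCalculus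

section Differential

/-! ### Differentials read in extended charts -/

variable {E : Type*} [NormedAddCommGroup E] [NormedSpace ℝ E]
  {H : Type*} [TopologicalSpace H] {I : ModelWithCorners ℝ E H}
  {M : Type*} [TopologicalSpace M] [ChartedSpace H M]
  {E' : Type*} [NormedAddCommGroup E'] [NormedSpace ℝ E']
  {H' : Type*} [TopologicalSpace H'] {I' : ModelWithCorners ℝ E' H'}
  {N : Type*} [TopologicalSpace N] [ChartedSpace H' N]

/-- At the base point of its preferred chart, the derivative of that chart is the identity, so
composing with the chart does not change a differential. -/
theorem differentialAt_apply [IsManifold I' 1 N] {f : M → N} {x : M} {y : N} (h : f x = y)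
    (hf : MDifferentiableAt I I' f x) (v : TangentSpace I x) :
    differentialAt I I' f x y h v = mfderiv I 𝓘(ℝ, E') (fun z ↦ extChartAt I' y (f z)) x v := by
  subst h
  have hc := mfderiv_comp x (mdifferentiableAt_extChartAt (I := I') (mem_chart_source H' (f x))) hf
  rw [mfderiv_extChartAt_self] at hc
  exact congr($hc v).symm

/-- Companion of `differentialAt_apply` for the domain: the inverse of the preferred chart also has
derivative the identity, and without boundary its derivative within the range is a full one. -/
theorem fderiv_comp_extChartAt_symm [IsManifold I 1 M] [I.Boundaryless] {k : M → E'} {x : M}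
    (hk : MDifferentiableAt I 𝓘(ℝ, E') k x) (v : E) :
    fderiv ℝ (fun a ↦ k ((extChartAt I x).symm a)) (extChartAt I x x) v =
      mfderiv I 𝓘(ℝ, E') k x v := by
  have hs := mdifferentiableWithinAt_extChartAt_symm (I := I) (mem_extChartAt_target (I := I) x)
  have hd := mfderivWithin_range_extChartAt_symm (I := I) (x := x)
  rw [I.range_eq_univ] at hs hd
  rw [mfderivWithin_univ] at hd
  rw [mdifferentiableWithinAt_univ] at hs
  have hc := mfderiv_comp_of_eq hk hs (extChartAt_to_inv x)
  rw [hd, mfderiv_eq_fderiv] at hc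
  rw [extChartAt_to_inv] at hc
  exact congr($hc v)

end Differential

section LieGroupChart

/-! ### The multiplication, bracket and adjoint action of a Lie group in the chart at the unit -/

open Filter VectorField
open scoped Topology

variable {E : Type*} [NormedAddCommGroup E] [NormedSpace ℝ E]
  {H : Type*} [TopologicalSpace H] (I : ModelWithCorners ℝ E H)
  (G : Type*) [TopologicalSpace G] [ChartedSpace H G] [Group G]

/-- The multiplication of `G` read in the extended chart at `1`. It has its meaning only near
`(φ 1, φ 1)`, where `φ` is that chart; elsewhere its values are arbitrary. -/
noncomputable def chartMul (q : E × E) : E :=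
  extChartAt I (1 : G) ((extChartAt I (1 : G)).symm q.1 * (extChartAt I (1 : G)).symm q.2)

theorem eventually_chartMul_left_unit [I.Boundaryless] :
    ∀ᶠ a in 𝓝 (extChartAt I (1 : G) 1), chartMul I G (extChartAt I (1 : G) 1, a) = a := by
  filter_upwards [extChartAt_target_mem_nhds (I := I) (1 : G)] with a ha
  simp only [chartMul, extChartAt_to_inv, one_mul, (extChartAt I (1 : G)).right_inv ha]

theorem eventually_chartMul_right_unit [I.Boundaryless] :
    ∀ᶠ a in 𝓝 (extChartAt I (1 : G) 1), chartMul I G (a, extChartAt I (1 : G) 1) = a := by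
  filter_upwards [extChartAt_target_mem_nhds (I := I) (1 : G)] with a ha
  simp only [chartMul, extChartAt_to_inv, mul_one, (extChartAt I (1 : G)).right_inv ha]

variable {I G}

theorem chartMul_extChartAt {g h : G} (hg : g ∈ (extChartAt I (1 : G)).source)
    (hh : h ∈ (extChartAt I (1 : G)).source) :
    chartMul I G (extChartAt I (1 : G) g, extChartAt I (1 : G) h) =
      extChartAt I (1 : G) (g * h) := by
  simp only [chartMul, (extChartAt I (1 : G)).left_inv hg, (extChartAt I (1 : G)).left_inv hh]

variable (I) in
/-- The adjoint action as an operator on the model space `E`, which underlies the tangent space at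
the unit. The calculus lemmas need this form, since tangent spaces carry no norm. -/
noncomputable def chartAd (g : G) : E →L[ℝ] E := lieAd I g

variable [LieGroup I ∞ G]

theorem contMDiff_conj (g : G) : ContMDiff I I ∞ (fun h : G ↦ g * h * g⁻¹) :=
  (contMDiff_mul_right (I := I) (n := ∞)).comp (contMDiff_mul_left (I := I) (n := ∞))

theorem mdifferentiableAt_extChartAt_conj (g : G) :
    MDifferentiableAt I 𝓘(ℝ, E) (fun h : G ↦ extChartAt I (1 : G) (g * h * g⁻¹)) 1 := by
  have hφ : MDifferentiableAt I 𝓘(ℝ, E) (extChartAt I (1 : G)) (g * 1 * g⁻¹) := by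
    rw [mul_one, mul_inv_cancel]
    exact mdifferentiableAt_extChartAt (mem_chart_source H 1)
  have hc : MDifferentiableAt I I (fun h : G ↦ g * h * g⁻¹) 1 :=
    (contMDiff_conj g).mdifferentiableAt (by simp)
  exact hφ.comp 1 hc

variable [I.Boundaryless]

theorem contDiffAt_chartMul {g h : G} (hg : g ∈ (extChartAt I (1 : G)).source)
    (hh : h ∈ (extChartAt I (1 : G)).source) (hgh : g * h ∈ (extChartAt I (1 : G)).source) :
    ContDiffAt ℝ ∞ (chartMul I G) (extChartAt I (1 : G) g, extChartAt I (1 : G) h) := by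
  have hsymm {g : G} (hg : g ∈ (extChartAt I (1 : G)).source) :
      ContMDiffAt 𝓘(ℝ, E) I ∞ (extChartAt I (1 : G)).symm (extChartAt I (1 : G) g) :=
    (contMDiffOn_extChartAt_symm (1 : G)).contMDiffAt
      ((isOpen_extChartAt_target (1 : G)).mem_nhds ((extChartAt I (1 : G)).map_source hg))
  rw [← contMDiffAt_iff_contDiffAt]
  have h1 : ContMDiffAt 𝓘(ℝ, E × E) I ∞ (fun q : E × E ↦ (extChartAt I (1 : G)).symm q.1)
      (extChartAt I (1 : G) g, extChartAt I (1 : G) h) :=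
    ContMDiffAt.comp (extChartAt I (1 : G) g, extChartAt I (1 : G) h) (hsymm hg)
      contDiff_fst.contMDiff.contMDiffAt
  have h2 : ContMDiffAt 𝓘(ℝ, E × E) I ∞ (fun q : E × E ↦ (extChartAt I (1 : G)).symm q.2)
      (extChartAt I (1 : G) g, extChartAt I (1 : G) h) :=
    ContMDiffAt.comp (extChartAt I (1 : G) g, extChartAt I (1 : G) h) (hsymm hh)
      contDiff_snd.contMDiff.contMDiffAt
  refine (contMDiffAt_extChartAt' ?_).comp_of_eq (h1.mul h2) rfl
  rw [← extChartAt_source I]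
  simpa only [(extChartAt I (1 : G)).left_inv hg, (extChartAt I (1 : G)).left_inv hh] using hgh

/-- The left-invariant vector field of `v` reads `a ↦ ∂₂m (a, φ 1) v` in the chart `φ` at `1`. -/
theorem mpullback_mulInvariantVectorField_extChartAt_symm (v : GroupLieAlgebra I G) :
    mpullbackWithin 𝓘(ℝ, E) I (extChartAt I (1 : G)).symm (mulInvariantVectorField v)
        (Set.range I) =ᶠ[𝓝 (extChartAt I (1 : G) 1)]
      fun a ↦ fderiv ℝ (chartMul I G) (a, extChartAt I (1 : G) 1) ((0 : E), (v : E)) := by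
  filter_upwards [extChartAt_target_mem_nhds (I := I) (1 : G)] with a ha
  set φ := extChartAt I (1 : G)
  have hg : φ.symm a ∈ φ.source := φ.map_target ha
  have h1 : (1 : G) ∈ φ.source := mem_extChartAt_source 1
  rw [mpullbackWithin_apply]
  -- The chart and its inverse have mutually inverse derivatives, so pulling back along the inverse
  -- chart is applying the derivative of the chart.
  have hinv : (mfderivWithin 𝓘(ℝ, E) I φ.symm (Set.range I) a).inverse =
      mfderiv I 𝓘(ℝ, E) φ (φ.symm a) :=
    ContinuousLinearMap.inverse_eq (mfderivWithin_extChartAt_symm_comp_mfderiv_extChartAt ha)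
      (mfderiv_extChartAt_comp_mfderivWithin_extChartAt_symm ha)
  rw [hinv, mulInvariantVectorField]
  have hφd : MDifferentiableAt I 𝓘(ℝ, E) φ (φ.symm a) :=
    mdifferentiableAt_extChartAt (by rwa [← extChartAt_source I])
  have hmul : MDifferentiableAt I I (fun h : G ↦ φ.symm a * h) 1 :=
    (contMDiff_mul_left (I := I) (n := ∞)).mdifferentiableAt (by simp)
  have hc := mfderiv_comp_of_eq hφd hmul (mul_one _)
  have hk : MDifferentiableAt I 𝓘(ℝ, E) (fun h : G ↦ φ (φ.symm a * h)) 1 :=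
    MDifferentiableAt.comp 1 (by rwa [mul_one]) hmul
  have hcm : DifferentiableAt ℝ (chartMul I G) (a, φ 1) := by
    have := (contDiffAt_chartMul hg h1 (by rwa [mul_one])).differentiableAt (by simp)
    rwa [φ.right_inv ha] at this
  have hd : HasFDerivAt (fun b ↦ φ (φ.symm a * φ.symm b)) _ (φ 1) :=
    HasFDerivAt.comp (g := chartMul I G) (φ 1) hcm.hasFDerivAt (hasFDerivAt_prodMk_right a (φ 1))
  have hk' := fderiv_comp_extChartAt_symm hk v
  rw [hd.fderiv] at hk'
  refine Eq.trans ?_ hk'.symm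
  have := congr($hc v)
  refine Eq.trans ?_ this.symm
  rw [mul_one]
  rfl

theorem bracket_eq_localBracket (v w : GroupLieAlgebra I G) :
    ⁅v, w⁆ = localBracket (chartMul I G) (extChartAt I (1 : G) 1) (v : E) (w : E) := by
  have h1 : (1 : G) ∈ (extChartAt I (1 : G)).source := mem_extChartAt_source 1
  have hm : ContDiffAt ℝ 2 (chartMul I G) (extChartAt I (1 : G) 1, extChartAt I (1 : G) 1) :=
    (contDiffAt_chartMul h1 h1 (by simp)).of_le (by norm_cast)
  refine Eq.trans ?_ (lieBracket_fderiv_apply_inr hm (eventually_chartMul_left_unit I G) v w)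
  rw [GroupLieAlgebra.bracket_def, ← mlieBracketWithin_univ, mlieBracketWithin_apply]
  have hinv : (mfderiv I 𝓘(ℝ, E) (extChartAt I (1 : G)) 1).inverse =
      ContinuousLinearMap.id ℝ E := by
    rw [mfderiv_extChartAt_self]
    exact ContinuousLinearMap.inverse_id
  -- Here `E` is used in place of `TangentSpace I 1`, which it equals by definition.
  refine Eq.trans congr($hinv _) ?_
  rw [Set.preimage_univ, Set.univ_inter, I.range_eq_univ]
  have hV := mpullback_mulInvariantVectorField_extChartAt_symm v
  have hW := mpullback_mulInvariantVectorField_extChartAt_symm w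
  rw [I.range_eq_univ] at hV hW
  exact congr($(lieBracketWithin_univ (E := E)) _).trans (hV.lieBracket_vectorField_eq hW)

/-- `Ad_g` is the derivative of conjugation by `g` read in the chart at `1`, for every `g`: only
`h` near `1`, never `g` itself, has to lie in the source of the chart. -/
theorem hasFDerivAt_extChartAt_conj (g : G) :
    HasFDerivAt (fun a ↦ extChartAt I (1 : G) (g * (extChartAt I (1 : G)).symm a * g⁻¹))
      (chartAd I g) (extChartAt I (1 : G) 1) := by
  have hk := mdifferentiableAt_extChartAt_conj (I := I) g
  have hc : MDifferentiableAt I I (fun h : G ↦ g * h * g⁻¹) 1 :=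
    (contMDiff_conj g).mdifferentiableAt (by simp)
  have hs : MDifferentiableAt 𝓘(ℝ, E) I (extChartAt I (1 : G)).symm (extChartAt I (1 : G) 1) := by
    have := mdifferentiableWithinAt_extChartAt_symm (I := I)
      (mem_extChartAt_target (I := I) (1 : G))
    rwa [I.range_eq_univ, mdifferentiableWithinAt_univ] at this
  have hd : DifferentiableAt ℝ
      (fun a ↦ extChartAt I (1 : G) (g * (extChartAt I (1 : G)).symm a * g⁻¹))
      (extChartAt I (1 : G) 1) :=
    mdifferentiableAt_iff_differentiableAt.1
      (MDifferentiableAt.comp (extChartAt I (1 : G) 1)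
        (g := fun h : G ↦ extChartAt I (1 : G) (g * h * g⁻¹)) (by rwa [extChartAt_to_inv]) hs)
  have heq : chartAd I g = _ := ContinuousLinearMap.ext fun v ↦
    (differentialAt_apply _ hc v).trans (fderiv_comp_extChartAt_symm hk v).symm
  rw [heq]
  exact hd.hasFDerivAt

/-- The identity `g * h = (g * h * g⁻¹) * g`, differentiated in `h` at `1`. -/
theorem fderiv_chartMul_lieAd {g : G} (hg : g ∈ (extChartAt I (1 : G)).source) (v : E) :
    fderiv ℝ (chartMul I G) (extChartAt I (1 : G) g, extChartAt I (1 : G) 1) (0, v) =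
      fderiv ℝ (chartMul I G) (extChartAt I (1 : G) 1, extChartAt I (1 : G) g)
        (chartAd I g v, 0) := by
  set φ := extChartAt I (1 : G)
  have h1 : (1 : G) ∈ φ.source := mem_extChartAt_source 1
  have hl := (contDiffAt_chartMul hg h1 (by rwa [mul_one])).differentiableAt (by simp)
  have hr := (contDiffAt_chartMul h1 hg (by rwa [one_mul])).differentiableAt (by simp)
  have hc := hasFDerivAt_extChartAt_conj (I := I) g
  have hc1 : φ (g * φ.symm (φ 1) * g⁻¹) = φ 1 := by
    rw [φ.left_inv h1, mul_one, mul_inv_cancel]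
  have hlhs : HasFDerivAt (fun b ↦ chartMul I G (φ g, b)) _ (φ 1) :=
    HasFDerivAt.comp (g := chartMul I G) (φ 1) hl.hasFDerivAt (hasFDerivAt_prodMk_right (φ g) (φ 1))
  have hrhs : HasFDerivAt (fun b ↦ chartMul I G (φ (g * φ.symm b * g⁻¹), φ g)) _ (φ 1) :=
    HasFDerivAt.comp (g := chartMul I G) (φ 1) (by rw [hc1]; exact hr.hasFDerivAt)
      (hc.prodMk (hasFDerivAt_const (φ g) (φ 1)))
  have hcont : ContinuousAt (fun b ↦ g * φ.symm b * g⁻¹) (φ 1) :=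
    ContinuousAt.comp (g := fun h : G ↦ g * h * g⁻¹)
      (contMDiff_conj (I := I) g).continuous.continuousAt
      (continuousAt_extChartAt_symm (I := I) (1 : G))
  -- Products can be read in the chart only where the conjugates stay in its source.
  have hmem : ∀ᶠ b in 𝓝 (φ 1), g * φ.symm b * g⁻¹ ∈ φ.source := by
    refine hcont.eventually_mem ?_
    rw [φ.left_inv h1, mul_one, mul_inv_cancel]
    exact extChartAt_source_mem_nhds (1 : G)
  have heq : (fun b ↦ chartMul I G (φ g, b)) =ᶠ[𝓝 (φ 1)]
      fun b ↦ chartMul I G (φ (g * φ.symm b * g⁻¹), φ g) := by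
    filter_upwards [hmem] with b hb
    rw [chartMul_extChartAt hb hg, inv_mul_cancel_right, chartMul, φ.left_inv hg]
  have := congr($(hlhs.unique (hrhs.congr_of_eventuallyEq heq)) v)
  simpa only [ContinuousLinearMap.comp_apply, ContinuousLinearMap.prod_apply,
    ContinuousLinearMap.inr_apply, _root_.zero_apply] using this

end LieGroupChart

section RotaBaxterChart

/-! ### Rota-Baxter operators in the chart at the unit -/

open Filter
open scoped Topology

variable {E : Type*} [NormedAddCommGroup E] [NormedSpace ℝ E]
  {H : Type*} [TopologicalSpace H] {I : ModelWithCorners ℝ E H}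
  {G : Type*} [TopologicalSpace G] [ChartedSpace H G] [Group G]

variable (I) in
/-- A map `𝔤 → G` read in the extended chart at `1`, as a map of the model space `E`. -/
noncomputable def readInChart (𝓑 : GroupLieAlgebra I G → G) (v : E) : E :=
  extChartAt I (1 : G) (𝓑 v)

namespace IsLieGroupRotaBaxter

variable {𝓑 : GroupLieAlgebra I G → G}

theorem eventually_mem_source (h𝓑 : IsLieGroupRotaBaxter I 𝓑) :
    ∀ᶠ x : E in 𝓝 0, 𝓑 x ∈ (extChartAt I (1 : G)).source := by
  refine (h𝓑.smooth.continuous.continuousAt (x := (0 : E))).eventually_mem ?_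
  exact h𝓑.map_zero ▸ extChartAt_source_mem_nhds (1 : G)

variable [LieGroup I ∞ G]

theorem contDiffAt_readInChart (h𝓑 : IsLieGroupRotaBaxter I 𝓑) {x : E}
    (hx : 𝓑 x ∈ (extChartAt I (1 : G)).source) :
    ContDiffAt ℝ ∞ (readInChart I 𝓑) x := by
  rw [← contMDiffAt_iff_contDiffAt]
  exact (contMDiffAt_extChartAt' (by rwa [← extChartAt_source I])).comp x (h𝓑.smooth x)

theorem differential_apply (h𝓑 : IsLieGroupRotaBaxter I 𝓑) (v : E) :
    h𝓑.differential v = fderiv ℝ (readInChart I 𝓑) 0 v := by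
  refine (differentialAt_apply (M := E) (f := fun v : E ↦ 𝓑 v) h𝓑.map_zero
    (h𝓑.smooth.mdifferentiableAt (by simp)) v).trans ?_
  exact congr($(mfderiv_eq_fderiv (E := E) (f := readInChart I 𝓑)) v)

/-- The Rota-Baxter identity `𝓑 x * 𝓑 y = 𝓑 (x + Ad_{𝓑 x} y)`, differentiated in `y` at `0`. -/
theorem fderiv_chartMul_apply [I.Boundaryless] (h𝓑 : IsLieGroupRotaBaxter I 𝓑) {x : E}
    (hx : 𝓑 x ∈ (extChartAt I (1 : G)).source) (y : E) :
    fderiv ℝ (chartMul I G) (extChartAt I (1 : G) (𝓑 x), extChartAt I (1 : G) 1)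
        (0, fderiv ℝ (readInChart I 𝓑) 0 y) =
      fderiv ℝ (readInChart I 𝓑) x (chartAd I (𝓑 x) y) := by
  set φ := extChartAt I (1 : G)
  have h1 : (1 : G) ∈ φ.source := mem_extChartAt_source 1
  have hB0 : 𝓑 (0 : E) = 1 := h𝓑.map_zero
  have hl := (contDiffAt_chartMul hx h1 (by rwa [mul_one])).differentiableAt (by simp)
  have hF0 := (h𝓑.contDiffAt_readInChart (x := (0 : E)) (by rw [hB0]; exact h1)).differentiableAt
    (by simp)
  have hFx := (h𝓑.contDiffAt_readInChart hx).differentiableAt (by simp)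
  have hlhs : HasFDerivAt (fun y : E ↦ chartMul I G (φ (𝓑 x), readInChart I 𝓑 y)) _ 0 :=
    HasFDerivAt.comp (g := chartMul I G) (0 : E)
      (by rw [readInChart, hB0]; exact hl.hasFDerivAt)
      ((hasFDerivAt_const (φ (𝓑 x)) (0 : E)).prodMk hF0.hasFDerivAt)
  have hrhs : HasFDerivAt (fun y : E ↦ readInChart I 𝓑 (x + chartAd I (𝓑 x) y)) _ 0 :=
    HasFDerivAt.comp (g := readInChart I 𝓑) (0 : E)
      (by rw [_root_.map_zero, add_zero]; exact hFx.hasFDerivAt)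
      ((chartAd I (𝓑 x)).hasFDerivAt.const_add x)
  have heq : (fun y : E ↦ chartMul I G (φ (𝓑 x), readInChart I 𝓑 y)) =ᶠ[𝓝 0]
      fun y : E ↦ readInChart I 𝓑 (x + chartAd I (𝓑 x) y) := by
    filter_upwards [h𝓑.eventually_mem_source] with y hy
    exact (chartMul_extChartAt hx hy).trans (congrArg φ (h𝓑.mul_eq x y))
  have := congr($(hlhs.unique (hrhs.congr_of_eventuallyEq heq)) y)
  simpa only [ContinuousLinearMap.comp_apply, ContinuousLinearMap.prod_apply,
    _root_.zero_apply] using this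

end IsLieGroupRotaBaxter

end RotaBaxterChart

theorem mainTheorem5
    {E : Type*} [NormedAddCommGroup E] [NormedSpace ℝ E] [FiniteDimensional ℝ E]
    {H : Type*} [TopologicalSpace H] (I : ModelWithCorners ℝ E H) [I.Boundaryless]
    {G : Type*} [TopologicalSpace G] [ChartedSpace H G] [Group G] [LieGroup I ∞ G]
    (𝓑 : GroupLieAlgebra I G → G) (h𝓑 : IsLieGroupRotaBaxter I 𝓑) :
    ∀ x y : GroupLieAlgebra I G,
      ⁅h𝓑.differential x, h𝓑.differential y⁆ =
        h𝓑.differential (⁅h𝓑.differential x, y⁆ + ⁅x, h𝓑.differential y⁆) := by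
  intro x y
  have : CompleteSpace E := FiniteDimensional.complete ℝ E
  have h2 : (2 : WithTop ℕ∞) ≤ ∞ := by norm_cast
  have h1 : (1 : G) ∈ (extChartAt I (1 : G)).source := mem_extChartAt_source 1
  have hB0 : 𝓑 (0 : E) = 1 := h𝓑.map_zero
  have hF := (h𝓑.contDiffAt_readInChart (x := (0 : E)) (by rw [hB0]; exact h1)).of_le h2
  have hm := (contDiffAt_chartMul h1 h1 (by simp)).of_le h2
  have key := localBracket_rotaBaxter hm (eventually_chartMul_left_unit I G)
    (eventually_chartMul_right_unit I G) hF (by rw [readInChart, hB0])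
    (A := fun x : E ↦ chartAd I (𝓑 x))
    (h𝓑.eventually_mem_source.mono fun x hx y ↦ fderiv_chartMul_lieAd hx y)
    (h𝓑.eventually_mem_source.mono fun x hx y ↦ h𝓑.fderiv_chartMul_apply hx y) x y
  have hB : (h𝓑.differential : E →L[ℝ] E) =
      fderiv ℝ (readInChart I 𝓑) 0 :=
    ContinuousLinearMap.ext h𝓑.differential_apply
  rw [← hB] at key
  exact (bracket_eq_localBracket _ _).trans (key.trans (congrArg h𝓑.differential
    (congrArg₂ (· + ·) (bracket_eq_localBracket _ _).symm (bracket_eq_localBracket _ _).symm)))
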